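/- Let $H$ be a reproducing kernel Hilbert space of real functions on $\mathbb R^{d}$ with continuous kernel $c$, and let the unknown $f\in H$ satisfy $\|f\|_{H}\le\zeta<\infty$ and be continuously differentiable with $L_g$-Lipschitz gradient. For data $(\xi_j,z_j)_{j\le l}$ and $\sigma>0$ the Gaussian process (posterior) mean is $m(x)=\bar c(x)^\top(\bar C+\sigma^2 I)^{-1}\bar z$, where $\bar C_{ij}=c(\xi_i,\xi_j)$, $\bar c(x)_i=c(x,\xi_i)$ and $\bar z=(z_j)_j$. For $\kappa=(\kappa_{ef},\kappa_{eg},\nu_1^m)$, a function $m$ is a $\kappa$ fully-linear model of $f$ on $B(x;\Delta)$ if $m\in C^1(\mathbb R^d)$, $\nabla m$ is $\nu_1^m$-Lipschitz, and for all $\|s\|\le\Delta$ $$|f(x+s)-m(x+s)|\le\kappa_{ef}\Delta^2,\qquad \|\nabla f(x+s)-\nabla m(x+s)\|\le\kappa_{eg}\Delta .$$ Consider one iteration of a trust-region method on a standard Borel probability space, and let $\mathcal F$ be the $\sigma$-algebra of the events before this iteration. The iterate $x$, the radius $\Delta$, the finite set of data collected so far, and a sequence of new sampling sites $y_1,y_2,\dots$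 are $\mathcal F$-measurable, and almost surely every open set that meets $B(x;\Delta)$ contains $y_i$ for infinitely many $i$. The new observations are $f(y_i)+\nu_i$ with independent $\nu_i\sim\mathcal N(0,\sigma^2)$, jointly independent of $\mathcal F$. Let $m_n$ be the Gaussian process mean computed from the earlier data and the first $n$ new observations. Let $\kappa_{ef}>0$, $\gamma_{lh}>0$, $\nu_1^m\ge L_g+\gamma_{lh}$, $\kappa_{eg},\kappa_{bhh}\in\mathbb R$, $\alpha\in(0,1)$ and $p>\alpha$. Assume that almost surely, for all sufficiently large $n$, the following holds with conditional probability at least $p$ given $\mathcal F$: the mismatch $h_n=f-m_n$ is continuously differentiable on $\mathbb R^d$ with $\gamma_{lh}$-Lipschitz gradient, is twice differentiable at $x$, and $\|\nabla^2h_n(x)\|\le\kappa_{bhh}$. (The case $p=1$ is that in which this holds almost surely.) If almost surely $$0<\Delta<\frac{6}{\gamma_{lh}}\left(\kappa_{eg}-2\kappa_{ef}-\kappa_{bhh}\right),$$ then almost surely there is a positive integer $N<\infty$ such that for every $n\ge N$ $$\mathbb P\left(m_n\text{ is a }\kappa\text{ fully-linear model of }f\text{ on }B(x;\Delta)\,\middle|\,\mathcal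 F\right)\ \ge\ \alpha .$$ -/

import Mathlib

open MeasureTheory ProbabilityTheory Filter Set
open scoped NNReal ENNReal Topology Gradient Matrix

namespace GPTrust

noncomputable section

/-- The scalar kernel `c(x, y)` of a real reproducing kernel Hilbert space `H` of real functions
on a set `X`, so that `⟪f, c(·, y)⟫ = f y` for `f` in `H`. -/
def scalarKernel {X : Type*} (H : Type*) [NormedAddCommGroup H] [InnerProductSpace ℝ H]
    [CompleteSpace H] [RKHS ℝ H X ℝ] (x y : X) : ℝ :=
  RKHS.kernel H x y 1

/-- The posterior mean of Gaussian process regression with prior covariance `c`, noise standard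
deviation `σ`, inputs `ξ` and outputs `z`:
`x ↦ c̄(x)ᵀ (C̄ + σ² I)⁻¹ z` with `C̄ i j = c (ξ i) (ξ j)` and `c̄(x) i = c x (ξ i)`. -/
def gpMean {X : Type*} (c : X → X → ℝ) (σ : ℝ) {l : ℕ} (ξ : Fin l → X) (z : Fin l → ℝ) (x : X) :
    ℝ :=
  (fun i => c x (ξ i)) ⬝ᵥ
    (((Matrix.of fun i j => c (ξ i) (ξ j)) + σ ^ 2 • (1 : Matrix (Fin l) (Fin l) ℝ))⁻¹ *ᵥ z)

/-- The posterior mean computed from `L` earlier data points `(ξ j, z j)` together with `n` new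
noisy evaluations `f (y i) + ν i` of `f` at the sites `y 0, …, y (n - 1)`. -/
def sampledMean {X : Type*} (c : X → X → ℝ) (σ : ℝ) (f : X → ℝ) (L : ℕ) (ξ : ℕ → X) (z : ℕ → ℝ)
    (y : ℕ → X) (ν : ℕ → ℝ) (n : ℕ) : X → ℝ :=
  gpMean c σ (Fin.append (fun j : Fin L => ξ j) (fun i : Fin n => y i))
    (Fin.append (fun j : Fin L => z j) (fun i : Fin n => f (y i) + ν i))

/-- `g` is continuously differentiable on the whole space and its gradient is Lipschitz with
constant `K`. -/
def IsLC1 {d : ℕ} (K : ℝ≥0) (g : EuclideanSpace ℝ (Fin d) → ℝ) : Prop :=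
  ContDiff ℝ 1 g ∧ LipschitzWith K (∇ g)

/-- `m` is a `(κef, κeg, κν)` fully-linear model of `f` on the ball `B(x; Δ)`. -/
def IsFullyLinear {d : ℕ} (κef κeg : ℝ) (κν : ℝ≥0) (f m : EuclideanSpace ℝ (Fin d) → ℝ)
    (x : EuclideanSpace ℝ (Fin d)) (Δ : ℝ) : Prop :=
  IsLC1 κν m ∧
    ∀ s ∈ Metric.closedBall (0 : EuclideanSpace ℝ (Fin d)) Δ,
      |f (x + s) - m (x + s)| ≤ κef * Δ ^ 2 ∧ ‖∇ f (x + s) - ∇ m (x + s)‖ ≤ κeg * Δ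

/-- The mismatch `f - m` has a Lipschitz gradient with constant `γ`, and at the iterate `x` it has
a Hessian (the derivative of the gradient) of operator norm at most `κbh`. -/
def IsRegularMismatch {d : ℕ} (γ : ℝ≥0) (κbh : ℝ) (f m : EuclideanSpace ℝ (Fin d) → ℝ)
    (x : EuclideanSpace ℝ (Fin d)) : Prop :=
  IsLC1 γ (f - m) ∧ DifferentiableAt ℝ (∇ (f - m)) x ∧ ‖fderiv ℝ (∇ (f - m)) x‖ ≤ κbh

/-- The sites `y` fill the ball `B(x; Δ)`: every open set that meets it is visited infinitely
often. Sites outside the ball are allowed. -/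
def FillsBall {d : ℕ} (y : ℕ → EuclideanSpace ℝ (Fin d)) (x : EuclideanSpace ℝ (Fin d)) (Δ : ℝ) :
    Prop :=
  ∀ U : Set (EuclideanSpace ℝ (Fin d)), IsOpen U → (U ∩ Metric.ball x Δ).Nonempty →
    {i | y i ∈ U}.Infinite

end

end GPTrust

namespace GPTrust

/-! ### From finitely many small values to uniform first-order smallness -/

section Deterministic

variable {d : ℕ} {h : EuclideanSpace ℝ (Fin d) → ℝ} {K K' : ℝ≥0}

/-! The posterior mean at `u` is linear in the outputs, and its weights minimise the squared RKHS
distance from `c(·, u)` to a combination of kernel sections, plus `σ²` times the squared `ℓ²` norm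
of the weights. Weights `1/k` on `k` new samples close to `u` cost at most `η² + σ²/k`, where `η`
bounds the RKHS distances of their sections to `c(·, u)`. Sites accumulate infinitely often at each
point of the ball, so the minimal cost tends to 0. It controls both parts of the mismatch at `u`:
the bias, an inner product of `f` with a vanishing residual (plus finitely many old-data terms with
vanishing weights), and the noise, whose variance is `σ²` times the vanishing sum of squared weights
(`exists_mismatch_decomposition`). Chebyshev's inequality then gives convergence in probability at
each fixed point.

Regularity upgrades this to the whole ball. A function with `γ`-Lipschitz gradient that is small on
a fine finite net and its coordinate shifts is small together with its gradient on the closed ball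
(`exists_finset_forall_small`). A union bound over these finitely many points costs less than `p -
α` for large `n`.

Everything runs under the regular conditional probability given the history, which almost surely
freezes the data, the sites and the radius (`ae_ae_condExpKernel_eq`) and keeps the second moments
of the noise (`ae_condExpKernel_moments`), all that Chebyshev needs. -/

theorem IsLC1.differentiable (hh : IsLC1 K h) : Differentiable ℝ h :=
  hh.1.differentiable (by norm_num)

theorem gradient_sub_of_differentiable {g : EuclideanSpace ℝ (Fin d) → ℝ}
    (hh : Differentiable ℝ h) (hg : Differentiable ℝ g) : ∇ (h - g) = ∇ h - ∇ g := by
  funext u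
  have := ((hh u).hasGradientAt.hasFDerivAt.sub (hg u).hasGradientAt.hasFDerivAt)
  rw [← map_sub] at this
  exact (hasGradientAt_iff_hasFDerivAt.2 this).gradient

theorem IsLC1.sub {g : EuclideanSpace ℝ (Fin d) → ℝ} (hh : IsLC1 K h) (hg : IsLC1 K' g) :
    IsLC1 (K + K') (h - g) := by
  refine ⟨hh.1.sub hg.1, ?_⟩
  rw [gradient_sub_of_differentiable hh.differentiable hg.differentiable]
  exact hh.2.sub hg.2

theorem IsLC1.mono (hh : IsLC1 K h) (hK : K ≤ K') : IsLC1 K' h :=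
  ⟨hh.1, hh.2.weaken hK⟩

/-- A first-order Taylor estimate. -/
theorem IsLC1.abs_sub_sub_inner_le (hh : IsLC1 K h) (u v : EuclideanSpace ℝ (Fin d)) :
    |h v - h u - inner ℝ (∇ h u) (v - u)| ≤ K * ‖v - u‖ ^ 2 := by
  -- The mean value inequality on this ball yields the constant `K`; the sharp `K / 2` is not
  -- needed.
  have key := Convex.norm_image_sub_le_of_norm_fderiv_le' (𝕜 := ℝ) (f := h) (C := K * ‖v - u‖)
    (s := Metric.closedBall u ‖v - u‖) (x := u) (y := v) (φ := fderiv ℝ h u)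
    (fun w _ => hh.differentiable w)
    (fun w hw => by
      rw [← toDual_gradient, ← toDual_gradient, ← map_sub, LinearIsometryEquiv.norm_map]
      refine (hh.2.norm_sub_le w u).trans ?_
      gcongr
      simpa [dist_eq_norm] using hw)
    (convex_closedBall _ _) (by simp) (by simp [dist_eq_norm])
  rw [inner_gradient_left, ← Real.norm_eq_abs, pow_two, ← mul_assoc]
  exact key

/-- If a function with Lipschitz gradient is at most `r ^ 2` at `v` and at the points `v + r eᵢ`,
then its gradient at `v` is of order `r`. -/
theorem IsLC1.norm_gradient_le (hh : IsLC1 K h) {v : EuclideanSpace ℝ (Fin d)} {r : ℝ} (hr : 0 < r)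
    (hv : |h v| ≤ r ^ 2) (hvi : ∀ i, |h (v + EuclideanSpace.single i r)| ≤ r ^ 2) :
    ‖∇ h v‖ ≤ d * (2 + K) * r := by
  have hi : ∀ i, |∇ h v i| ≤ (2 + K) * r := fun i => by
    have h1 := hh.abs_sub_sub_inner_le v (v + EuclideanSpace.single i r)
    have h2 : inner ℝ (∇ h v) (EuclideanSpace.single i r) = r * ∇ h v i := by
      rw [EuclideanSpace.inner_single_right]; simp
    rw [add_sub_cancel_left, h2, PiLp.norm_single, Real.norm_eq_abs, sq_abs] at h1
    have h3 := hvi i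
    rw [abs_le] at h1 h3 hv
    have h4 : |r * ∇ h v i| ≤ r * ((2 + K) * r) := by
      rw [abs_le]; constructor <;> nlinarith
    rw [abs_mul, abs_of_pos hr] at h4
    exact le_of_mul_le_mul_left h4 hr
  calc ‖∇ h v‖ = ‖∑ i, EuclideanSpace.single i (∇ h v i)‖ := by
        congr 1
        ext j
        simp [Finset.sum_apply]
    _ ≤ ∑ i, ‖EuclideanSpace.single i (∇ h v i)‖ := norm_sum_le _ _
    _ ≤ ∑ _i : Fin d, (2 + K) * r := Finset.sum_le_sum fun i _ => by
        simpa using hi i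
    _ = d * (2 + K) * r := by simp; ring

/-- A function with `K`-Lipschitz gradient which is small on a suitable finite subset of a ball is
uniformly small on the closed ball together with its gradient. -/
theorem exists_finset_forall_small (K : ℝ≥0) (x : EuclideanSpace ℝ (Fin d)) {Δ a b : ℝ}
    (hΔ : 0 < Δ) (ha : 0 < a) (hb : 0 < b) :
    ∃ S : Finset (EuclideanSpace ℝ (Fin d)), ↑S ⊆ Metric.ball x Δ ∧ ∃ ε > 0,
      ∀ h, IsLC1 K h → (∀ u ∈ S, |h u| ≤ ε) →
        ∀ u ∈ Metric.closedBall x Δ, |h u| ≤ a ∧ ‖∇ h u‖ ≤ b := by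
  classical
  -- A net point within `3r` of `u` has gradient at most `d(2+K)r`, and moving to `u` adds `3Kr`, so
  -- `‖∇h u‖ ≤ A r`. The Taylor estimate then gives `|h u| ≤ (1 + 3A) r²`.
  set A : ℝ := d * (2 + K) + 3 * K with hA
  have hA0 : 0 ≤ A := by positivity
  obtain ⟨r, hr, hrΔ, hra, hrb⟩ : ∃ r : ℝ, 0 < r ∧ 2 * r < Δ ∧ (1 + 3 * A) * r ^ 2 ≤ a ∧
      A * r ≤ b := by
    have e1 : ∀ᶠ r in 𝓝[>] (0 : ℝ), 2 * r < Δ := by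
      have : Tendsto (fun r : ℝ => 2 * r) (𝓝 0) (𝓝 (2 * 0)) := by
        apply Continuous.tendsto; fun_prop
      exact nhdsWithin_le_nhds (this.eventually (gt_mem_nhds (by simpa using hΔ)))
    have e2 : ∀ᶠ r in 𝓝[>] (0 : ℝ), (1 + 3 * A) * r ^ 2 < a := by
      have : Tendsto (fun r : ℝ => (1 + 3 * A) * r ^ 2) (𝓝 0) (𝓝 ((1 + 3 * A) * 0 ^ 2)) := by
        apply Continuous.tendsto; fun_prop
      exact nhdsWithin_le_nhds (this.eventually (gt_mem_nhds (by simpa using ha)))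
    have e3 : ∀ᶠ r in 𝓝[>] (0 : ℝ), A * r < b := by
      have : Tendsto (fun r : ℝ => A * r) (𝓝 0) (𝓝 (A * 0)) := by
        apply Continuous.tendsto; fun_prop
      exact nhdsWithin_le_nhds (this.eventually (gt_mem_nhds (by simpa using hb)))
    obtain ⟨r, ⟨⟨h1, h2⟩, h3⟩, h4⟩ := (((e1.and e2).and e3).and self_mem_nhdsWithin).exists
    exact ⟨r, h4, h1, h2.le, h3.le⟩
  -- Shrinking the ball by `2r` keeps the shifted points `v + r eᵢ` inside the open ball.
  obtain ⟨t, hts, htf, hcov⟩ :=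
    (isCompact_closedBall x (Δ - 2 * r)).finite_cover_balls hr
  refine ⟨htf.toFinset ∪ (htf.toFinset ×ˢ Finset.univ).image
    (fun q : EuclideanSpace ℝ (Fin d) × Fin d => q.1 + EuclideanSpace.single q.2 r), ?_, r ^ 2,
    by positivity, ?_⟩
  · intro u hu
    simp only [Finset.coe_union, Finite.coe_toFinset, Finset.coe_image, Finset.coe_product,
      Finset.coe_univ, Set.mem_union, Set.mem_image, Set.mem_prod, Set.mem_univ, and_true,
      Prod.exists] at hu
    rcases hu with hu | ⟨v, i, hv, rfl⟩
    · have := hts hu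
      rw [Metric.mem_closedBall] at this
      rw [Metric.mem_ball]
      linarith
    · have := hts hv
      rw [Metric.mem_closedBall] at this
      rw [Metric.mem_ball]
      have h1 : dist (v + EuclideanSpace.single i r) v = r := by
        simp [dist_eq_norm, abs_of_pos hr]
      linarith [dist_triangle (v + EuclideanSpace.single i r) v x]
  · intro h hh hS u hu
    obtain ⟨v, hv, huv⟩ : ∃ v ∈ t, ‖u - v‖ ≤ 3 * r := by
      -- Contracting `u` radially towards `x` reaches the shrunken ball at a distance of at most
      -- `2r`.
      obtain ⟨u', hu', huu'⟩ : ∃ u' ∈ Metric.closedBall x (Δ - 2 * r), ‖u - u'‖ ≤ 2 * r := by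
        have hΔ2 : 0 ≤ 1 - 2 * r / Δ := by
          rw [sub_nonneg, div_le_one hΔ]; exact hrΔ.le
        have hn : ‖u - x‖ ≤ Δ := by simpa [dist_eq_norm] using hu
        refine ⟨x + (1 - 2 * r / Δ) • (u - x), ?_, ?_⟩
        · rw [Metric.mem_closedBall, dist_eq_norm, add_sub_cancel_left, norm_smul,
            Real.norm_of_nonneg hΔ2]
          calc (1 - 2 * r / Δ) * ‖u - x‖ ≤ (1 - 2 * r / Δ) * Δ := by gcongr
            _ = Δ - 2 * r := by field_simp
        · have : u - (x + (1 - 2 * r / Δ) • (u - x)) = (2 * r / Δ) • (u - x) := by module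
          rw [this, norm_smul, Real.norm_of_nonneg (by positivity)]
          calc 2 * r / Δ * ‖u - x‖ ≤ 2 * r / Δ * Δ := by gcongr
            _ = 2 * r := by field_simp
      obtain ⟨v, hv, hvu⟩ := mem_iUnion₂.1 (hcov hu')
      refine ⟨v, hv, ?_⟩
      rw [Metric.mem_ball, dist_eq_norm] at hvu
      linarith [norm_sub_le_norm_sub_add_norm_sub u u' v]
    have hv0 : |h v| ≤ r ^ 2 := hS v (by simp [hv])
    have hvi : ∀ i, |h (v + EuclideanSpace.single i r)| ≤ r ^ 2 := fun i =>
      hS _ (Finset.mem_union_right _ (Finset.mem_image.2 ⟨(v, i), by simp [hv], rfl⟩))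
    have hg := hh.norm_gradient_le hr hv0 hvi
    have hgu : ‖∇ h u‖ ≤ A * r := by
      have h1 := hh.2.norm_sub_le u v
      have h2 : (K : ℝ) * ‖u - v‖ ≤ K * (3 * r) := by gcongr
      have h3 := norm_le_norm_add_norm_sub (∇ h v) (∇ h u)
      rw [norm_sub_rev] at h3
      rw [hA]; nlinarith
    refine ⟨?_, hgu.trans hrb⟩
    have h1 := hh.abs_sub_sub_inner_le v u
    have h2 : |inner ℝ (∇ h v) (u - v)| ≤ (d * (2 + K) * r) * (3 * r) :=
      (abs_real_inner_le_norm _ _).trans (by gcongr)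
    have h3 : (K : ℝ) * ‖u - v‖ ^ 2 ≤ K * (3 * r) ^ 2 := by gcongr
    have h4 : (1 + 3 * A) * r ^ 2 = r ^ 2 + (d * (2 + K) * r) * (3 * r) + K * (3 * r) ^ 2 := by
      rw [hA]; ring
    refine le_trans ?_ hra
    rw [h4]
    rw [abs_le] at *
    constructor <;> linarith

/-- A model with regular mismatch is fully linear as soon as the mismatch is small at suitable
finitely many points of the ball. -/
theorem exists_finset_isFullyLinear {f : EuclideanSpace ℝ (Fin d) → ℝ} {Lg κν γ : ℝ≥0}
    (hf : IsLC1 Lg f) (hκν : Lg + γ ≤ κν) {κef κeg κbh : ℝ} (hκef : 0 < κef)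
    (x : EuclideanSpace ℝ (Fin d)) {Δ : ℝ} (hΔ : 0 < Δ)
    (hΔ' : Δ < 6 / γ * (κeg - 2 * κef - κbh)) :
    ∃ S : Finset (EuclideanSpace ℝ (Fin d)), ↑S ⊆ Metric.ball x Δ ∧ ∃ ε > 0,
      ∀ m, IsRegularMismatch γ κbh f m x → (∀ u ∈ S, |f u - m u| ≤ ε) →
        IsFullyLinear κef κeg κν f m x Δ := by
  have hκ : 0 < κeg - 2 * κef - κbh :=
    pos_of_mul_pos_right (hΔ.trans hΔ') (by positivity)
  -- The Hessian and radius bounds serve only to make `κeg` positive: a negative `κbh` bounds no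
  -- norm, and otherwise `κeg > 2κef + κbh > 0`.
  by_cases hbh : κbh < 0
  · exact ⟨∅, by simp, 1, one_pos, fun m hm => absurd (hm.2.2.trans_lt hbh) (norm_nonneg _).not_gt⟩
  have hκeg : 0 < κeg := by linarith
  obtain ⟨S, hS, ε, hε, hsmall⟩ := exists_finset_forall_small γ x hΔ
    (mul_pos hκef (pow_pos hΔ 2)) (mul_pos hκeg hΔ)
  refine ⟨S, hS, ε, hε, fun m hm hmS => ?_⟩
  have hmLC : IsLC1 (Lg + γ) m := by simpa using hf.sub hm.1
  refine ⟨hmLC.mono hκν, fun s hs => ?_⟩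
  have key := hsmall _ hm.1 hmS (x + s) (by simpa [dist_eq_norm] using hs)
  rw [gradient_sub_of_differentiable hf.differentiable hmLC.differentiable] at key
  exact key

end Deterministic

/-! ### The posterior mean as a regularised least-squares problem in the RKHS -/

section Posterior

variable {X : Type*} {H : Type*} [NormedAddCommGroup H] [InnerProductSpace ℝ H] [CompleteSpace H]
  [RKHS ℝ H X ℝ]

variable (H) in
/-- The function `c(·, u)` as an element of the reproducing kernel Hilbert space. -/
noncomputable def feature (u : X) : H := RKHS.kerFun H u 1

theorem inner_feature_left (u : X) (f : H) : inner ℝ (feature H u) f = f u := by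
  rw [feature, RKHS.kerFun_inner]; simp

theorem scalarKernel_eq_inner (u v : X) :
    scalarKernel H u v = inner ℝ (feature H u) (feature H v) := by
  rw [inner_feature_left, feature, RKHS.kerFun_apply, scalarKernel]

/-- The squared distance between the features of `v` and `u` is `c(v,v) - 2c(v,u) + c(u,u)`. -/
theorem continuous_feature [TopologicalSpace X]
    (hc : Continuous fun q : X × X => scalarKernel H q.1 q.2) :
    Continuous (feature H (X := X)) := by
  rw [continuous_iff_continuousAt]
  intro u
  rw [ContinuousAt, tendsto_iff_norm_sub_tendsto_zero]
  have h1 : ∀ v, ‖feature H v - feature H u‖ =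
      √(scalarKernel H v v - 2 * scalarKernel H v u + scalarKernel H u u) := fun v => by
    rw [scalarKernel_eq_inner, scalarKernel_eq_inner, scalarKernel_eq_inner,
      real_inner_self_eq_norm_sq, real_inner_self_eq_norm_sq, ← norm_sub_sq_real,
      Real.sqrt_sq (norm_nonneg _)]
  have hcont : ∀ k : X → X → ℝ, (Continuous fun q : X × X => k q.1 q.2) →
      Continuous fun v => √(k v v - 2 * k v u + k u u) := fun k hk => by
    have e1 : Continuous fun v => k v v :=
      hk.comp (f := fun v => (v, v)) (continuous_id.prodMk continuous_id)
    have e2 : Continuous fun v => k v u :=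
      hk.comp (f := fun v => (v, u)) (continuous_id.prodMk continuous_const)
    fun_prop
  have h2 := (hcont (scalarKernel H) hc).tendsto u
  rw [← h1, sub_self, norm_zero] at h2
  exact h2.congr fun v => (h1 v).symm

/-- The objective minimised by the weights of the posterior mean at `u`. -/
noncomputable def weightCost (H : Type*) [NormedAddCommGroup H] [InnerProductSpace ℝ H]
    [CompleteSpace H] [RKHS ℝ H X ℝ] (σ : ℝ) {l : ℕ} (ξ : Fin l → X) (u : X)
    (v : Fin l → ℝ) : ℝ :=
  ‖feature H u - ∑ i, v i • feature H (ξ i)‖ ^ 2 + σ ^ 2 * ∑ i, v i ^ 2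

/-- The posterior mean at `u` is a linear functional of the outputs, whose weights minimise
`weightCost`. -/
theorem exists_weights {σ : ℝ} (hσ : 0 < σ) {l : ℕ} (ξ : Fin l → X) (u : X) :
    ∃ w : Fin l → ℝ, (∀ z, gpMean (scalarKernel H) σ ξ z u = ∑ i, w i * z i) ∧
      ∀ v, weightCost H σ ξ u w ≤ weightCost H σ ξ u v := by
  set A : Matrix (Fin l) (Fin l) ℝ :=
    (Matrix.of fun i j => scalarKernel H (ξ i) (ξ j)) + σ ^ 2 • 1 with hA
  have hgram : (Matrix.of fun i j => scalarKernel H (ξ i) (ξ j)) =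
      Matrix.gram ℝ (fun i => feature H (ξ i)) := by
    ext i j
    simp [scalarKernel_eq_inner, Matrix.gram_apply]
  have hpos : A.PosDef := by
    rw [hA, hgram]
    exact Matrix.PosDef.posSemidef_add (Matrix.posSemidef_gram ℝ _)
      (Matrix.PosDef.smul Matrix.PosDef.one (by positivity))
  have hsymm : Aᵀ = A := by simpa using hpos.isHermitian.eq
  have hunit : IsUnit A.det := (Matrix.isUnit_iff_isUnit_det _).1 hpos.isUnit
  refine ⟨A⁻¹ *ᵥ (fun i => scalarKernel H u (ξ i)), fun z => ?_, fun v => ?_⟩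
  · rw [gpMean, ← hA, Matrix.dotProduct_mulVec, ← Matrix.mulVec_transpose,
      Matrix.transpose_nonsing_inv, hsymm]
    rfl
  · set w := A⁻¹ *ᵥ (fun i => scalarKernel H u (ξ i)) with hw
    have hAw : A *ᵥ w = fun i => scalarKernel H u (ξ i) := by
      rw [hw, Matrix.mulVec_mulVec, Matrix.mul_nonsing_inv _ hunit, Matrix.one_mulVec]
    set R : H := feature H u - ∑ i, w i • feature H (ξ i) with hR
    -- These are the normal equations of `weightCost`, read off from `A w = c̄(u)`.
    have horth : ∀ i, inner ℝ R (feature H (ξ i)) = σ ^ 2 * w i := fun i => by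
      have h1 := congrFun hAw i
      rw [hA, Matrix.add_mulVec, Pi.add_apply, Matrix.smul_mulVec, Matrix.one_mulVec, Pi.smul_apply,
        smul_eq_mul] at h1
      have h2 : (Matrix.of fun i j => scalarKernel H (ξ i) (ξ j)).mulVec w i =
          inner ℝ (∑ j, w j • feature H (ξ j)) (feature H (ξ i)) := by
        rw [sum_inner]
        simp only [Matrix.mulVec, dotProduct, Matrix.of_apply, real_inner_smul_left,
          scalarKernel_eq_inner]
        exact Finset.sum_congr rfl fun j _ => by rw [real_inner_comm, mul_comm]
      rw [hR, inner_sub_left, ← h2, ← scalarKernel_eq_inner]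
      linarith
    set D : H := ∑ i, (v i - w i) • feature H (ξ i) with hD
    have hRD : feature H u - ∑ i, v i • feature H (ξ i) = R - D := by
      simp only [hR, hD, sub_smul, Finset.sum_sub_distrib]; abel
    have hin : inner ℝ R D = ∑ i, (v i - w i) * (σ ^ 2 * w i) := by
      simp only [hD, inner_sum, real_inner_smul_right, horth]
    rw [weightCost, weightCost, hRD, ← hR, norm_sub_sq_real R D, hin]
    -- The cross terms cancel by the normal equations, leaving the excess cost `‖D‖² + σ² ∑ (vᵢ -
    -- wᵢ)² ≥ 0`.
    have hsq : σ ^ 2 * ∑ i, v i ^ 2 = σ ^ 2 * ∑ i, w i ^ 2 + 2 * ∑ i, (v i - w i) * (σ ^ 2 * w i) +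
        σ ^ 2 * ∑ i, (v i - w i) ^ 2 := by
      simp only [Finset.mul_sum, ← Finset.sum_add_distrib]
      exact Finset.sum_congr rfl fun i _ => by ring
    rw [hsq]
    have h0 : 0 ≤ σ ^ 2 * ∑ i, (v i - w i) ^ 2 :=
      mul_nonneg (sq_nonneg _) (Finset.sum_nonneg fun i _ => sq_nonneg _)
    nlinarith [sq_nonneg ‖D‖]

/-- Uniform weights on finitely many sites with features close to the one of `u` are cheap. -/
theorem exists_weightCost_append_le (σ : ℝ) {L : ℕ} (ξ : Fin L → X) (y : ℕ → X) (u : X)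
    {T : Finset ℕ} (hT : T.Nonempty) {η : ℝ}
    (hη : ∀ i ∈ T, ‖feature H u - feature H (y i)‖ ≤ η) {n : ℕ} (hn : ∀ i ∈ T, i < n) :
    ∃ v, weightCost H σ (Fin.append ξ (fun i : Fin n => y i)) u v ≤ η ^ 2 + σ ^ 2 / T.card := by
  classical
  set k : ℝ := (T.card : ℝ) with hk
  have hkpos : 0 < k := by rw [hk]; exact_mod_cast hT.card_pos
  have hsub : Finset.range n ∩ T = T :=
    Finset.inter_eq_right.2 fun i hi => Finset.mem_range.2 (hn i hi)
  refine ⟨Fin.append (fun _ => 0) (fun i => if (i : ℕ) ∈ T then k⁻¹ else 0), ?_⟩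
  have h1 : (∑ i : Fin n, (if (i : ℕ) ∈ T then k⁻¹ else 0) • feature H (y i)) =
      ∑ i ∈ T, k⁻¹ • feature H (y i) := by
    rw [Fin.sum_univ_eq_sum_range (fun i => (if i ∈ T then k⁻¹ else 0) • feature H (y i))]
    simp only [ite_smul, zero_smul, Finset.sum_ite_mem, hsub]
  have h2 : (∑ i : Fin n, (if (i : ℕ) ∈ T then k⁻¹ else 0) ^ 2) = k⁻¹ := by
    rw [Fin.sum_univ_eq_sum_range (fun i => (if i ∈ T then k⁻¹ else (0 : ℝ)) ^ 2)]
    simp only [ite_pow, ne_eq, OfNat.ofNat_ne_zero, not_false_eq_true, zero_pow,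
      Finset.sum_ite_mem, hsub, Finset.sum_const, nsmul_eq_mul, ← hk]
    field_simp
  have h3 : feature H u - ∑ i ∈ T, k⁻¹ • feature H (y i) =
      ∑ i ∈ T, k⁻¹ • (feature H u - feature H (y i)) := by
    simp only [smul_sub, Finset.sum_sub_distrib, Finset.sum_const, ← Nat.cast_smul_eq_nsmul ℝ,
      ← hk, smul_smul, mul_inv_cancel₀ hkpos.ne', one_smul]
  have h4 : ‖∑ i ∈ T, k⁻¹ • (feature H u - feature H (y i))‖ ≤ η :=
    calc _ ≤ ∑ i ∈ T, k⁻¹ * η := norm_sum_le_of_le _ fun i hi => by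
          rw [norm_smul, Real.norm_of_nonneg (by positivity)]
          gcongr
          exact hη i hi
      _ = η := by simp only [Finset.sum_const, nsmul_eq_mul, ← hk]; field_simp
  simp only [weightCost, Fin.sum_univ_add, Fin.append_left, Fin.append_right, zero_smul,
    Finset.sum_const_zero, zero_add, ne_eq, OfNat.ofNat_ne_zero, not_false_eq_true, zero_pow, h1,
    h2, h3]
  rw [div_eq_mul_inv]
  gcongr

/-- If every neighbourhood of `u` is visited infinitely often, the mismatch at `u` of the posterior
mean splits into a vanishing deterministic part and a linear functional of the noise whose weights
vanish in `ℓ²`. -/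
theorem exists_mismatch_decomposition [TopologicalSpace X]
    (hc : Continuous fun q : X × X => scalarKernel H q.1 q.2) (f : H) {σ : ℝ} (hσ : 0 < σ)
    (L : ℕ) (ξ : ℕ → X) (z : ℕ → ℝ) (y : ℕ → X) (u : X)
    (hy : ∀ U, IsOpen U → u ∈ U → {i | y i ∈ U}.Infinite) :
    ∃ (b : ℕ → ℝ) (w : (n : ℕ) → Fin n → ℝ), Tendsto b atTop (𝓝 0) ∧
      Tendsto (fun n => ∑ i, w n i ^ 2) atTop (𝓝 0) ∧
      ∀ n ν, f u - sampledMean (scalarKernel H) σ f L ξ z y ν n u = b n - ∑ i, w n i * ν i := by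
  set ξ' : (n : ℕ) → Fin (L + n) → X :=
    fun n => Fin.append (fun j : Fin L => ξ j) (fun i : Fin n => y i) with hξ'
  choose w hw hmin using fun n => exists_weights (H := H) hσ (ξ' n) u
  set V : ℕ → ℝ := fun n => weightCost H σ (ξ' n) u (w n) with hV
  have hV0 : ∀ n, 0 ≤ V n := fun n => by
    simp only [hV, weightCost]
    exact add_nonneg (sq_nonneg _)
      (mul_nonneg (sq_nonneg _) (Finset.sum_nonneg fun i _ => sq_nonneg _))
  have hVlim : Tendsto V atTop (𝓝 0) := by
    refine Metric.tendsto_atTop.2 fun δ hδ => ?_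
    -- Half of `δ` pays for `η²` and half for `σ²/k`. The `k` visits are counted by index, so
    -- repeated sites are allowed.
    obtain ⟨k, hk⟩ := exists_nat_gt (2 * σ ^ 2 / δ)
    have hη : 0 < √(δ / 2) := Real.sqrt_pos.2 (by positivity)
    obtain ⟨T, hTU, hTk⟩ := (hy ((feature H) ⁻¹' Metric.ball (feature H u) √(δ / 2))
      (Metric.isOpen_ball.preimage (continuous_feature hc)) (by simpa using hη)
      ).exists_subset_card_eq k
    have hkpos : (0 : ℝ) < k := lt_of_le_of_lt (by positivity) hk
    have hTne : T.Nonempty := Finset.card_pos.1 (by rw [hTk]; exact_mod_cast hkpos)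
    refine ⟨T.sup id + 1, fun n hn => ?_⟩
    obtain ⟨v, hv⟩ := exists_weightCost_append_le (H := H) σ (fun j : Fin L => ξ j) y u hTne
      (η := √(δ / 2)) (n := n)
      (fun i hi => by
        have : ‖feature H (y i) - feature H u‖ < √(δ / 2) := by
          simpa [dist_eq_norm] using hTU hi
        rw [norm_sub_rev]; exact this.le)
      (fun i hi => by
        have : i ≤ T.sup id := Finset.le_sup (f := id) hi
        omega)
    rw [Real.dist_eq, sub_zero, abs_of_nonneg (hV0 n)]
    refine (hmin n v).trans_lt (hv.trans_lt ?_)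
    rw [Real.sq_sqrt (by positivity), hTk]
    have : σ ^ 2 / k < δ / 2 := by
      rw [div_lt_iff₀ hδ] at hk
      rw [div_lt_iff₀ hkpos]
      linarith
    linarith
  set R : ℕ → H := fun n => feature H u - ∑ i, w n i • feature H (ξ' n i) with hR
  have hRV : ∀ n, ‖R n‖ ^ 2 ≤ V n := fun n => by
    simp only [hV, weightCost]
    exact le_add_of_nonneg_right
      (mul_nonneg (sq_nonneg _) (Finset.sum_nonneg fun i _ => sq_nonneg _))
  have hwV : ∀ n, ∑ i, w n i ^ 2 ≤ V n / σ ^ 2 := fun n => by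
    rw [le_div_iff₀ (by positivity), mul_comm]
    simp only [hV, weightCost]
    exact le_add_of_nonneg_left (sq_nonneg _)
  have hwsplit : ∀ n, ∑ i, w n i ^ 2 =
      ∑ j, w n (Fin.castAdd n j) ^ 2 + ∑ i, w n (Fin.natAdd L i) ^ 2 := fun n =>
    Fin.sum_univ_add _
  have hVσ : Tendsto (fun n => V n / σ ^ 2) atTop (𝓝 0) := by
    simpa using hVlim.div_const (σ ^ 2)
  have hRlim : Tendsto R atTop (𝓝 0) := by
    rw [tendsto_zero_iff_norm_tendsto_zero]
    refine squeeze_zero (fun n => norm_nonneg _) (fun n => Real.le_sqrt_of_sq_le (hRV n)) ?_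
    simpa using hVlim.sqrt
  have hwlim : ∀ j : Fin L, Tendsto (fun n => w n (Fin.castAdd n j)) atTop (𝓝 0) := fun j => by
    rw [tendsto_zero_iff_abs_tendsto_zero]
    refine squeeze_zero (fun n => abs_nonneg _) (fun n => Real.abs_le_sqrt
      ((Finset.single_le_sum (f := fun i => w n i ^ 2) (fun i _ => sq_nonneg _)
        (Finset.mem_univ (Fin.castAdd n j))).trans (hwV n))) ?_
    simpa using hVσ.sqrt
  -- The old outputs are arbitrary numbers; there are `L` of them for every `n`, so their vanishing
  -- weights suffice.
  refine ⟨fun n => inner ℝ (R n) f - ∑ j : Fin L, w n (Fin.castAdd n j) * (z j - f (ξ j)),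
    fun n i => w n (Fin.natAdd L i), ?_, ?_, fun n ν => ?_⟩
  · have h1 : Tendsto (fun n => inner ℝ (R n) f) atTop (𝓝 (inner ℝ (0 : H) f)) :=
      hRlim.inner tendsto_const_nhds
    have h2 : Tendsto (fun n => ∑ j : Fin L, w n (Fin.castAdd n j) * (z j - f (ξ j))) atTop
        (𝓝 (∑ j : Fin L, 0 * (z j - f (ξ j)))) :=
      tendsto_finsetSum _ fun j _ => (hwlim j).mul_const _
    simpa using h1.sub h2
  · refine squeeze_zero (fun n => Finset.sum_nonneg fun i _ => sq_nonneg _) (fun n => ?_) hVσ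
    refine le_trans ?_ (hwV n)
    rw [hwsplit]
    exact le_add_of_nonneg_left (Finset.sum_nonneg fun i _ => sq_nonneg _)
  · have h1 : inner ℝ (R n) f = f u - (∑ j : Fin L, w n (Fin.castAdd n j) * f (ξ j) +
        ∑ i : Fin n, w n (Fin.natAdd L i) * f (y i)) := by
      simp only [hR, hξ', inner_sub_left, inner_add_left, sum_inner, real_inner_smul_left,
        inner_feature_left,
        Fin.sum_univ_add, Fin.append_left, Fin.append_right]
    rw [sampledMean, hw n]
    simp only [h1, Fin.sum_univ_add, Fin.append_left, Fin.append_right, mul_add, mul_sub,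
      Finset.sum_add_distrib, Finset.sum_sub_distrib]
    ring

end Posterior

/-! ### Second moments of the noise and conditioning on the history -/

/-- Chebyshev's inequality for linear combinations of white noise. -/
theorem measure_abs_sum_ge_le {Ω : Type*} [MeasurableSpace Ω] {P : Measure Ω} [IsFiniteMeasure P]
    {v : ℝ} {ν : ℕ → Ω → ℝ}
    (hν : ∀ i j, Integrable (fun ω => ν i ω * ν j ω) P ∧
      ∫ ω, ν i ω * ν j ω ∂P = if i = j then v else 0) {n : ℕ} (w : Fin n → ℝ) {δ : ℝ} (hδ : 0 < δ) :
    P {ω | δ ≤ |∑ i, w i * ν i ω|} ≤ ENNReal.ofReal (v * (∑ i, w i ^ 2) / δ ^ 2) := by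
  have hexp : ∀ ω, (∑ i, w i * ν i ω) ^ 2 = ∑ i, ∑ j, w i * w j * (ν i ω * ν j ω) := fun ω => by
    rw [pow_two, Finset.sum_mul_sum]
    exact Finset.sum_congr rfl fun i _ => Finset.sum_congr rfl fun j _ => by ring
  have hi : ∀ i j : Fin n, Integrable (fun ω => w i * w j * (ν i ω * ν j ω)) P := fun i j =>
    (hν i j).1.const_mul _
  have hInt : Integrable (fun ω => (∑ i, w i * ν i ω) ^ 2) P := by
    simp_rw [hexp]
    exact integrable_finsetSum _ fun i _ => integrable_finsetSum _ fun j _ => hi i j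
  have hval : ∫ ω, (∑ i, w i * ν i ω) ^ 2 ∂P = v * ∑ i, w i ^ 2 := by
    simp_rw [hexp]
    rw [integral_finsetSum _ fun i _ => integrable_finsetSum _ fun j _ => hi i j]
    simp_rw [integral_finsetSum _ fun j _ => hi _ j, integral_const_mul, (hν _ _).2, Fin.val_inj]
    rw [Finset.mul_sum]
    exact Finset.sum_congr rfl fun i _ => by simp; ring
  have hmk := mul_meas_ge_le_integral_of_nonneg (ae_of_all P fun ω => sq_nonneg _) hInt (δ ^ 2)
  rw [hval] at hmk
  have hset : {ω | δ ≤ |∑ i, w i * ν i ω|} = {ω | δ ^ 2 ≤ (∑ i, w i * ν i ω) ^ 2} := by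
    ext ω
    simp only [mem_ofPred_eq]
    rw [sq_le_sq, abs_of_pos hδ]
  rw [hset, ← ofReal_measureReal]
  exact ENNReal.ofReal_le_ofReal ((le_div_iff₀' (by positivity)).2 hmk)

section Conditioning

variable {Ω : Type*} {m : MeasurableSpace Ω} [mΩ : MeasurableSpace Ω] [StandardBorelSpace Ω]
  {μ : Measure Ω} [IsProbabilityMeasure μ]

/-- Under the regular conditional probability given `m`, an `m`-measurable map is almost surely
constant. -/
theorem ae_ae_condExpKernel_eq (hm : m ≤ mΩ) {β : Type*} [MeasurableSpace β]
    [MeasurableSpace.CountablySeparated β] {g : Ω → β} (hg : Measurable[m] g) :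
    ∀ᵐ ω ∂μ, ∀ᵐ ω' ∂condExpKernel μ m ω, g ω' = g ω := by
  obtain ⟨S, hS, hsep⟩ := exists_seq_separating β MeasurableSet.empty univ
  -- The conditional expectation of the indicator of an `m`-measurable set is that indicator, so the
  -- kernel gives the set mass 0 or 1. Countably many such sets separate the values of `g`.
  have key : ∀ k, ∀ᵐ ω ∂μ, ∀ᵐ ω' ∂condExpKernel μ m ω, g ω' ∈ S k ↔ g ω ∈ S k := fun k => by
    have hs : MeasurableSet[m] (g ⁻¹' S k) := hg (hS k)
    have hs' : MeasurableSet (g ⁻¹' S k) := hm _ hs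
    have h1 := condExpKernel_ae_eq_condExp (μ := μ) hm hs'
    rw [condExp_of_stronglyMeasurable hm (stronglyMeasurable_const.indicator hs)
      ((integrable_const _).indicator hs')] at h1
    filter_upwards [h1] with ω hω
    by_cases hmem : g ω ∈ S k
    · have h2 : (condExpKernel μ m ω).real (g ⁻¹' S k) = 1 := by
        rw [hω, indicator_of_mem (by exact hmem)]
      have h3 : ∀ᵐ ω' ∂condExpKernel μ m ω, ω' ∈ g ⁻¹' S k := by
        refine (mem_ae_iff_prob_eq_one hs').2 ?_
        rw [← ofReal_measureReal, h2, ENNReal.ofReal_one]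
      filter_upwards [h3] with ω' hω'
      exact iff_of_true hω' hmem
    · have h2 : (condExpKernel μ m ω).real (g ⁻¹' S k) = 0 := by
        rw [hω, indicator_of_notMem (by exact hmem)]
      have h3 : ∀ᵐ ω' ∂condExpKernel μ m ω, ω' ∉ g ⁻¹' S k := by
        rw [measureReal_eq_zero_iff] at h2
        exact measure_eq_zero_iff_ae_notMem.1 h2
      filter_upwards [h3] with ω' hω'
      exact iff_of_false hω' hmem
  filter_upwards [ae_all_iff.2 key] with ω hω
  filter_upwards [ae_all_iff.2 hω] with ω' hω'
  exact hsep _ (mem_univ _) _ (mem_univ _) hω'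

/-- Conditioning on an independent sigma-algebra does not change the second moments of centred
Gaussian white noise. -/
theorem ae_condExpKernel_moments (hm : m ≤ mΩ) {v : ℝ≥0} {ν : ℕ → Ω → ℝ}
    (hνm : ∀ i, Measurable (ν i)) (hνind : iIndepFun ν μ)
    (hνlaw : ∀ i, μ.map (ν i) = gaussianReal 0 v)
    (hνm' : Indep (MeasurableSpace.comap (fun ω i => ν i ω) MeasurableSpace.pi) m μ) :
    ∀ᵐ ω ∂μ, ∀ i j, Integrable (fun ω' => ν i ω' * ν j ω') (condExpKernel μ m ω) ∧
      ∫ ω', ν i ω' * ν j ω' ∂condExpKernel μ m ω = if i = j then (v : ℝ) else 0 := by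
  have hLp : ∀ i, MemLp (ν i) 2 μ := fun i => by
    have h1 := memLp_id_gaussianReal' (μ := 0) (v := v) 2 (by simp)
    rw [← hνlaw i] at h1
    exact h1.comp_of_map (hνm i).aemeasurable
  have hmean : ∀ i, ∫ ω, ν i ω ∂μ = 0 := fun i => by
    have h1 := integral_id_gaussianReal (μ := 0) (v := v)
    rwa [← hνlaw i, integral_map (hνm i).aemeasurable (by fun_prop)] at h1
  have hvar : ∀ i, ∫ ω, ν i ω * ν i ω ∂μ = v := fun i => by
    have h1 := variance_id_gaussianReal (μ := 0) (v := v)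
    rw [← hνlaw i, variance_map (by fun_prop) (hνm i).aemeasurable, Function.id_comp,
      variance_of_integral_eq_zero (hνm i).aemeasurable (hmean i)] at h1
    rw [← h1]
    simp only [pow_two]
  have hInt : ∀ i j, Integrable (fun ω => ν i ω * ν j ω) μ := fun i j =>
    (hLp i).integrable_mul (hLp j)
  have hmom : ∀ i j, ∫ ω, ν i ω * ν j ω ∂μ = if i = j then (v : ℝ) else 0 := fun i j => by
    split_ifs with hij
    · rw [hij, hvar]
    · rw [(hνind.indepFun hij).integral_fun_mul_eq_mul_integral
        (hνm i).aestronglyMeasurable (hνm j).aestronglyMeasurable, hmean, zero_mul]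
  have hle : MeasurableSpace.comap (fun ω i => ν i ω) MeasurableSpace.pi ≤ mΩ :=
    (measurable_pi_lambda _ hνm).comap_le
  rw [ae_all_iff]
  intro i
  rw [ae_all_iff]
  intro j
  have hsm : StronglyMeasurable[MeasurableSpace.comap (fun ω i => ν i ω) MeasurableSpace.pi]
      (fun ω => ν i ω * ν j ω) := by
    have h1 : Measurable fun q : ℕ → ℝ => q i * q j := by fun_prop
    exact (h1.comp (comap_measurable (fun ω i => ν i ω))).stronglyMeasurable
  filter_upwards [(hInt i j).condExpKernel_ae (m := m),
    condExp_ae_eq_integral_condExpKernel hm (hInt i j),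
    condExp_indep_eq hle hm hsm hνm'] with ω h1 h2 h3
  refine ⟨h1, ?_⟩
  rw [← h2, h3, hmom]

end Conditioning

/-! ### Pointwise convergence in probability and the union bound -/

/-- If the noise is white under `P`, the sites fill the ball and the mismatch is regular with
probability at least `p` eventually, then the models are eventually fully linear with any smaller
probability. -/
theorem eventually_le_measure_isFullyLinear {d : ℕ}
    {H : Type*} [NormedAddCommGroup H] [InnerProductSpace ℝ H] [CompleteSpace H]
    [RKHS ℝ H (EuclideanSpace ℝ (Fin d)) ℝ]
    (hc : Continuous fun q : EuclideanSpace ℝ (Fin d) × EuclideanSpace ℝ (Fin d) =>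
      scalarKernel H q.1 q.2)
    (f : H) {Lg : ℝ≥0} (hf : IsLC1 Lg (f : EuclideanSpace ℝ (Fin d) → ℝ))
    {κef κeg κbh : ℝ} {κν γ : ℝ≥0} (hκef : 0 < κef) (hκν : Lg + γ ≤ κν)
    {α p : ℝ} (hα : 0 ≤ α) (hp : α < p)
    {Ω : Type*} [MeasurableSpace Ω] {P : Measure Ω} [IsFiniteMeasure P]
    {x : EuclideanSpace ℝ (Fin d)} {Δ : ℝ} (hΔ : 0 < Δ)
    (hΔ' : Δ < 6 / γ * (κeg - 2 * κef - κbh))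
    (L : ℕ) (ξ : ℕ → EuclideanSpace ℝ (Fin d)) (z : ℕ → ℝ) {y : ℕ → EuclideanSpace ℝ (Fin d)}
    (hy : FillsBall y x Δ) {σ : ℝ} (hσ : 0 < σ) {v : ℝ} {ν : ℕ → Ω → ℝ}
    (hν : ∀ i j, Integrable (fun ω => ν i ω * ν j ω) P ∧
      ∫ ω, ν i ω * ν j ω ∂P = if i = j then v else 0)
    (hmis : ∀ᶠ n in atTop, ENNReal.ofReal p ≤ P {ω | IsRegularMismatch γ κbh f
      (sampledMean (scalarKernel H) σ f L ξ z y (fun i => ν i ω) n) x}) :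
    ∀ᶠ n in atTop, ENNReal.ofReal α ≤ P {ω | IsFullyLinear κef κeg κν f
      (sampledMean (scalarKernel H) σ f L ξ z y (fun i => ν i ω) n) x Δ} := by
  obtain ⟨S, hS, ε, hε, hFL⟩ := exists_finset_isFullyLinear hf hκν hκef x hΔ hΔ'
  set bad : EuclideanSpace ℝ (Fin d) → ℕ → Set Ω := fun u n =>
    {ω | ε < |f u - sampledMean (scalarKernel H) σ f L ξ z y (fun i => ν i ω) n u|} with hbad
  have hbad0 : ∀ u ∈ S, Tendsto (fun n => P (bad u n)) atTop (𝓝 0) := fun u hu => by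
    obtain ⟨b, w, hb, hw, hdec⟩ := exists_mismatch_decomposition hc f hσ L ξ z y u
      (fun U hU huU => hy U hU ⟨u, huU, hS hu⟩)
    have hlim : Tendsto (fun n => ENNReal.ofReal (v * (∑ i, w n i ^ 2) / (ε / 2) ^ 2)) atTop
        (𝓝 0) := by
      have := ENNReal.tendsto_ofReal ((hw.const_mul v).div_const ((ε / 2) ^ 2))
      simpa using this
    refine tendsto_of_tendsto_of_tendsto_of_le_of_le' tendsto_const_nhds hlim
      (Eventually.of_forall fun _ => zero_le) ?_
    have hb' : ∀ᶠ n in atTop, |b n| < ε / 2 :=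
      (tendsto_zero_iff_abs_tendsto_zero b).1 hb |>.eventually (gt_mem_nhds (half_pos hε))
    filter_upwards [hb'] with n hn
    refine (measure_mono fun ω hω => ?_).trans (measure_abs_sum_ge_le hν (w n) (half_pos hε))
    simp only [hbad, mem_ofPred_eq, hdec] at hω ⊢
    have := abs_sub (b n) (∑ i, w n i * ν i ω)
    linarith
  have hsum : Tendsto (fun n => ∑ u ∈ S, P (bad u n)) atTop (𝓝 0) := by
    simpa using tendsto_finsetSum S hbad0
  have hpα : 0 < ENNReal.ofReal (p - α) := ENNReal.ofReal_pos.2 (sub_pos.2 hp)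
  filter_upwards [hmis, hsum.eventually (gt_mem_nhds hpα)] with n hn hbn
  -- Only monotonicity and subadditivity of `P` follow, so these events need not be shown
  -- measurable.
  have hcover : {ω | IsRegularMismatch γ κbh f
        (sampledMean (scalarKernel H) σ f L ξ z y (fun i => ν i ω) n) x} ⊆
      {ω | IsFullyLinear κef κeg κν f
        (sampledMean (scalarKernel H) σ f L ξ z y (fun i => ν i ω) n) x Δ} ∪
      ⋃ u ∈ S, bad u n := fun ω hω => by
    by_cases hsmall : ∀ u ∈ S,
        |f u - sampledMean (scalarKernel H) σ f L ξ z y (fun i => ν i ω) n u| ≤ ε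
    · exact Or.inl (hFL _ hω hsmall)
    · push Not at hsmall
      obtain ⟨u, hu, hlt⟩ := hsmall
      exact Or.inr (mem_iUnion₂.2 ⟨u, hu, hlt⟩)
  have hle := hn.trans ((measure_mono hcover).trans ((measure_union_le _ _).trans
    (add_le_add_right ((measure_biUnion_finset_le S _).trans hbn.le) _)))
  have hsplit : ENNReal.ofReal p = ENNReal.ofReal α + ENNReal.ofReal (p - α) := by
    rw [← ENNReal.ofReal_add hα (sub_pos.2 hp).le, add_sub_cancel]
  rw [hsplit] at hle
  exact ENNReal.le_of_add_le_add_right ENNReal.ofReal_ne_top hle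

end GPTrust

open GPTrust in
/-- One iteration of the trust-region method: the sigma-algebra `𝓖` is the history before the
iteration; the current iterate `x`, the radius `Δ`, the data set collected so far (`L` points
`ξ j` with values `z j`) and the new sampling sites `y i` are determined by the history, and the
noise `ν i` of the new evaluations is independent of it. Probabilities given the history are
regular conditional probabilities. -/
theorem theorem2 {d : ℕ}
    -- the reproducing kernel Hilbert space, its kernel, and the unknown function
    {H : Type*} [NormedAddCommGroup H] [InnerProductSpace ℝ H] [CompleteSpace H]
    [RKHS ℝ H (EuclideanSpace ℝ (Fin d)) ℝ]
    (hc : Continuous fun q : EuclideanSpace ℝ (Fin d) × EuclideanSpace ℝ (Fin d) =>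
      scalarKernel H q.1 q.2)
    (f : H) (ζ : ℝ) (hζ : ‖f‖ ≤ ζ) (Lg : ℝ≥0) (hf : IsLC1 Lg (f : EuclideanSpace ℝ (Fin d) → ℝ))
    -- the constants
    (κef κeg κbhh : ℝ) (κν γ : ℝ≥0) (hκef : 0 < κef) (hγ : 0 < γ) (hκν : Lg + γ ≤ κν)
    (α p : ℝ) (hα : α ∈ Ioo (0 : ℝ) 1) (hp : α < p)
    -- the probability space and the history
    {Ω : Type*} (𝓖 : MeasurableSpace Ω) [mΩ : MeasurableSpace Ω] [StandardBorelSpace Ω]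
    (μ : Measure Ω) [IsProbabilityMeasure μ] (h𝓖 : 𝓖 ≤ mΩ)
    (x : Ω → EuclideanSpace ℝ (Fin d)) (hx : Measurable[𝓖] x)
    (Δ : Ω → ℝ) (hΔm : Measurable[𝓖] Δ)
    (L : Ω → ℕ) (hL : Measurable[𝓖] L)
    (ξ : ℕ → Ω → EuclideanSpace ℝ (Fin d)) (hξ : ∀ j, Measurable[𝓖] (ξ j))
    (z : ℕ → Ω → ℝ) (hz : ∀ j, Measurable[𝓖] (z j))
    -- the new samples
    (y : ℕ → Ω → EuclideanSpace ℝ (Fin d)) (hy : ∀ i, Measurable[𝓖] (y i))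
    (hfill : ∀ᵐ ω ∂μ, FillsBall (fun i => y i ω) (x ω) (Δ ω))
    (σ : ℝ≥0) (hσ : 0 < σ)
    (ν : ℕ → Ω → ℝ) (hνm : ∀ i, Measurable[mΩ] (ν i)) (hνind : iIndepFun ν μ)
    (hνlaw : ∀ i, μ.map (ν i) = gaussianReal 0 (σ ^ 2))
    (hν𝓖 : Indep (MeasurableSpace.comap (fun ω i => ν i ω) MeasurableSpace.pi) 𝓖 μ)
    -- given the history, the mismatch is regular with probability at least `p` (almost surely if
    -- `p = 1`; as Gaussian noise is unbounded, a smaller `p` is the case of interest)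
    (hmis : ∀ᵐ ω ∂μ, ∀ᶠ n in atTop, ENNReal.ofReal p ≤ condExpKernel μ 𝓖 ω
      {ω' | IsRegularMismatch γ κbhh f
        (sampledMean (scalarKernel H) σ f (L ω') (fun j => ξ j ω') (fun j => z j ω')
          (fun i => y i ω') (fun i => ν i ω') n) (x ω')})
    -- the condition on the radius
    (hΔ : ∀ᵐ ω ∂μ, 0 < Δ ω ∧ Δ ω < 6 / γ * (κeg - 2 * κef - κbhh)) :
    ∀ᵐ ω ∂μ, ∃ N : ℕ, 0 < N ∧ ∀ n ≥ N, ENNReal.ofReal α ≤ condExpKernel μ 𝓖 ω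
      {ω' | IsFullyLinear κef κeg κν f
        (sampledMean (scalarKernel H) σ f (L ω') (fun j => ξ j ω') (fun j => z j ω')
          (fun i => y i ω') (fun i => ν i ω') n) (x ω') (Δ ω')} := by
  have hdata : ∀ᵐ ω ∂μ, ∀ᵐ ω' ∂condExpKernel μ 𝓖 ω, x ω' = x ω ∧ Δ ω' = Δ ω ∧ L ω' = L ω ∧
      (∀ j, ξ j ω' = ξ j ω) ∧ (∀ j, z j ω' = z j ω) ∧ ∀ i, y i ω' = y i ω := by
    filter_upwards [ae_ae_condExpKernel_eq (μ := μ) h𝓖 hx, ae_ae_condExpKernel_eq (μ := μ) h𝓖 hΔm,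
      ae_ae_condExpKernel_eq (μ := μ) h𝓖 hL,
      ae_all_iff.2 fun j => ae_ae_condExpKernel_eq (μ := μ) h𝓖 (hξ j),
      ae_all_iff.2 fun j => ae_ae_condExpKernel_eq (μ := μ) h𝓖 (hz j),
      ae_all_iff.2 fun i => ae_ae_condExpKernel_eq (μ := μ) h𝓖 (hy i)] with ω h1 h2 h3 h4 h5 h6
    filter_upwards [h1, h2, h3, ae_all_iff.2 h4, ae_all_iff.2 h5, ae_all_iff.2 h6]
      with ω' e1 e2 e3 e4 e5 e6
    exact ⟨e1, e2, e3, e4, e5, e6⟩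
  filter_upwards [hdata, ae_condExpKernel_moments h𝓖 hνm hνind hνlaw hν𝓖, hfill, hmis, hΔ]
    with ω hω hmom hfillω hmisω hΔω
  -- Under the kernel at `ω` the history takes its value at `ω` almost surely, so only the noise
  -- stays random.
  have hReg : ∀ n, condExpKernel μ 𝓖 ω {ω' | IsRegularMismatch γ κbhh f
        (sampledMean (scalarKernel H) σ f (L ω') (fun j => ξ j ω') (fun j => z j ω')
          (fun i => y i ω') (fun i => ν i ω') n) (x ω')} =
      condExpKernel μ 𝓖 ω {ω' | IsRegularMismatch γ κbhh f
        (sampledMean (scalarKernel H) σ f (L ω) (fun j => ξ j ω) (fun j => z j ω)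
          (fun i => y i ω) (fun i => ν i ω') n) (x ω)} := fun n => by
    refine measure_congr ?_
    filter_upwards [hω] with ω' ⟨e1, e2, e3, e4, e5, e6⟩
    refine propext ?_
    change IsRegularMismatch _ _ _ _ _ ↔ IsRegularMismatch _ _ _ _ _
    simp only [e1, e3, e4, e5, e6]
  have hLin : ∀ n, condExpKernel μ 𝓖 ω {ω' | IsFullyLinear κef κeg κν f
        (sampledMean (scalarKernel H) σ f (L ω') (fun j => ξ j ω') (fun j => z j ω')
          (fun i => y i ω') (fun i => ν i ω') n) (x ω') (Δ ω')} =
      condExpKernel μ 𝓖 ω {ω' | IsFullyLinear κef κeg κν f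
        (sampledMean (scalarKernel H) σ f (L ω) (fun j => ξ j ω) (fun j => z j ω)
          (fun i => y i ω) (fun i => ν i ω') n) (x ω) (Δ ω)} := fun n => by
    refine measure_congr ?_
    filter_upwards [hω] with ω' ⟨e1, e2, e3, e4, e5, e6⟩
    refine propext ?_
    change IsFullyLinear _ _ _ _ _ _ _ ↔ IsFullyLinear _ _ _ _ _ _ _
    simp only [e1, e2, e3, e4, e5, e6]
  simp only [hReg] at hmisω
  simp only [hLin]
  obtain ⟨N, hN⟩ := eventually_atTop.1 (eventually_le_measure_isFullyLinear hc f hf hκef hκν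
    hα.1.le hp hΔω.1 hΔω.2 (L ω) (fun j => ξ j ω) (fun j => z j ω) hfillω
    (NNReal.coe_pos.2 hσ) hmom hmisω)
  exact ⟨N + 1, N.succ_pos, fun n hn => hN n (by omega)⟩
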